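/- **Theorem 2.3.** Let $K$ be a compact Hausdorff space that is scattered, i.e. every non-empty closed subset $L \subseteq K$ has a point that is isolated in $L$. Let $C(K)$ be the Banach space of continuous functions on $K$ with real or complex values, with the supremum norm, and let $B = \{x \in C(K) : \|x\| \le 1\}$ be its closed unit ball. For $f \in C(K)^*$ with $\|f\| = 1$ and $\varepsilon > 0$ write $$S(f,\varepsilon) = \{x \in B : \operatorname{Re} f(x) > 1 - \varepsilon\}.$$ Let $f_1,\dots,f_n \in C(K)^*$ with $\|f_i\| = 1$, let $\varepsilon_1,\dots,\varepsilon_n > 0$, and let $\lambda_1,\dots,\lambda_n \ge 0$ with $\sum_{i=1}^n \lambda_i = 1$. Then the set $$\sum_{i=1}^n \lambda_i S(f_i,\varepsilon_i) = \Big\{\sum_{i=1}^n \lambda_i z_i : z_i \in S(f_i,\varepsilon_i) \text{ for } 1 \le i \le n\Big\}$$ is relatively weakly open in $B$, i.e. it equals $B \cap U$ for some set $U \subseteq C(K)$ that is open in the weak topology of $C(K)$. -/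

import Mathlib

/-- A topological space is scattered if every nonempty closed subset `L` has an isolated
point in `L` (a point that is relatively open in `L`). -/
def IsScatteredSpace (K : Type*) [TopologicalSpace K] : Prop :=
  ∀ L : Set K, IsClosed L → L.Nonempty → ∃ t ∈ L, ∃ U : Set K, IsOpen U ∧ U ∩ L = {t}

/-- The slice `S(f, ε) = {x ∈ B_X : Re f(x) > 1 - ε}` of the closed unit ball of `X`.
(It is used for `‖f‖ = 1` and `ε > 0`.) -/
def unitBallSlice {𝕜 X : Type*} [RCLike 𝕜] [NormedAddCommGroup X] [NormedSpace 𝕜 X]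
    (f : X →L[𝕜] 𝕜) (ε : ℝ) : Set X :=
  {x | x ∈ Metric.closedBall (0 : X) 1 ∧ 1 - ε < RCLike.re (f x)}

/-- The linear combination `∑ i, c i • A i = {∑ i, c i • z i : z i ∈ A i}` of finitely many
sets, with real coefficients. -/
def setCombination (𝕜 : Type*) {X : Type*} [RCLike 𝕜] [NormedAddCommGroup X] [NormedSpace 𝕜 X]
    {n : ℕ} (c : Fin n → ℝ) (A : Fin n → Set X) : Set X :=
  {x | ∃ z : Fin n → X, (∀ i, z i ∈ A i) ∧ x = ∑ i, (c i : 𝕜) • z i}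

/-- `C` is a relatively weakly open subset of `B`: it is the trace on `B` of a set that is open
in the weak topology of `X`. -/
def IsRelWeaklyOpen (𝕜 : Type*) {X : Type*} [RCLike 𝕜] [NormedAddCommGroup X] [NormedSpace 𝕜 X]
    (C B : Set X) : Prop :=
  ∃ U : Set (WeakSpace 𝕜 X), IsOpen U ∧ C = B ∩ (toWeakSpace 𝕜 X) ⁻¹' U

/-!
Write `B` for the unit ball of `C(K, 𝕜)`. Two facts carry the proof.

* On a scattered compact space every functional is, up to an arbitrarily small error in norm,
  concentrated on a finite set: for `δ > 0` there is a finite `F ⊆ K` with `‖f g‖ ≤ δ * ‖g‖` for all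
  `g` vanishing on `F` (`exists_finite_norm_apply_le`). This is the part of Rudin's theorem (measures
  on scattered compact spaces are atomic) that is needed. The proof takes a minimal closed set `L`
  such that the statement holds for the `g` that vanish on `L`. An isolated point of `L` could be
  moved from `L` to `F`, so `L` has none, and it is empty.
* In the unit ball of `𝕜`, the map `w ↦ ∑ i, c i * w i` has continuous right inverses that pass as
  close as desired to any given `w` (`exists_continuous_splitting`). If `x = ∑ i, c i * w i` has norm
  less than `1`, the points `w i` are first pulled slightly towards `x`, into the interior of the
  ball, and can then be translated by `p - x`. If `‖x‖ = 1`, strict convexity gives `w i = x` whenever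
  `c i ≠ 0`.

Now let `x = ∑ i, c i • z i` with `z i` in the given slices, and let `F` be a finite set that almost
carries all the `f i`. If `y ∈ B` is close to `x` at the points of `F`, which is a weakly open
condition, apply at each `t ∈ F` such a right inverse `T t` to `y`, and glue these with bump functions
`ψ t` and `y` itself to `u i = y + ∑ t, ψ t • (T t i ∘ y - y)`. Pointwise, this is a convex
combination of elements of the unit ball of `𝕜`, so `u i ∈ B`; moreover `∑ i, c i • u i = y`, and
`u i` is close to `z i` on `F`. Hence `f i (u i)` is close to `f i (z i)`, so `u i` is in the `i`-th
slice.
-/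

open Topology

/-! ### Functionals on spaces of continuous functions -/

/-- Shrinking the values of `g` towards `0` by `η` moves `g` by at most `η` and turns the set where
`g` is small into a set where the function vanishes. -/
lemma ContinuousMap.exists_truncation {𝕜 K : Type*} [RCLike 𝕜] [TopologicalSpace K] [CompactSpace K]
    (g : C(K, 𝕜)) {η : ℝ} (hη : 0 < η) :
    ∃ g' : C(K, 𝕜), ‖g - g'‖ ≤ η ∧ (∀ s, ‖g' s‖ ≤ ‖g s‖) ∧ ∀ s, ‖g s‖ ≤ η → g' s = 0 := by
  have hpos : ∀ s, 0 < max ‖g s‖ η := fun s => lt_max_of_lt_right hη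
  have hle : ∀ s, η / max ‖g s‖ η ≤ 1 := fun s => (div_le_one (hpos s)).2 (le_max_right _ _)
  have hnn : ∀ s, 0 ≤ η / max ‖g s‖ η := fun s => (div_pos hη (hpos s)).le
  have hcont : Continuous fun s => g s * ((1 - η / max ‖g s‖ η : ℝ) : 𝕜) := by
    refine g.continuous.mul (RCLike.continuous_ofReal.comp ?_)
    exact continuous_const.sub
      (continuous_const.div (g.continuous.norm.max continuous_const) fun s => (hpos s).ne')
  refine ⟨⟨_, hcont⟩, ?_, ?_, ?_⟩
  · rw [ContinuousMap.norm_le _ hη.le]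
    intro s
    have : (g - ⟨_, hcont⟩ : C(K, 𝕜)) s = g s * ((η / max ‖g s‖ η : ℝ) : 𝕜) := by
      simp only [ContinuousMap.sub_apply, ContinuousMap.coe_mk]
      push_cast
      ring
    rw [this, norm_mul, RCLike.norm_ofReal, abs_of_nonneg (hnn s), mul_div_assoc',
      div_le_iff₀ (hpos s), mul_comm]
    exact mul_le_mul_of_nonneg_left (le_max_left _ _) hη.le
  · intro s
    simp only [ContinuousMap.coe_mk]
    rw [norm_mul, RCLike.norm_ofReal, abs_of_nonneg (sub_nonneg.2 (hle s))]
    exact mul_le_of_le_one_right (norm_nonneg _) (by linarith [hnn s])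
  · intro s hs
    simp only [ContinuousMap.coe_mk, max_eq_right hs, div_self hη.ne', sub_self, RCLike.ofReal_zero,
      mul_zero]

/-- Almost all of the mass of `f` off the closed set `L` sits on a finite set: functions vanishing
on `L` and on a suitable finite set `F` are sent by `f` to small scalars. -/
def IsNearlyFiniteOff {𝕜 K : Type*} [RCLike 𝕜] [TopologicalSpace K] [CompactSpace K]
    (f : C(K, 𝕜) →L[𝕜] 𝕜) (L : Set K) : Prop :=
  ∀ δ : ℝ, 0 < δ → ∃ F : Set K, F.Finite ∧
    ∀ g : C(K, 𝕜), ‖g‖ ≤ 1 → (∀ s ∈ L, g s = 0) → (∀ s ∈ F, g s = 0) → ‖f g‖ ≤ δ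

section

variable {𝕜 K : Type*} [RCLike 𝕜] [TopologicalSpace K] [CompactSpace K]

/-- For functions that are nowhere both nonzero, unimodular factors line up the values of `f` without
leaving the unit ball. -/
lemma exists_norm_apply_eq_add (f : C(K, 𝕜) →L[𝕜] 𝕜) {g h : C(K, 𝕜)} (hg : ‖g‖ ≤ 1) (hh : ‖h‖ ≤ 1)
    (hgh : ∀ s, g s = 0 ∨ h s = 0) :
    ∃ a b : 𝕜, ‖a • g + b • h‖ ≤ 1 ∧ ‖f (a • g + b • h)‖ = ‖f g‖ + ‖f h‖ := by
  obtain ⟨a, ha, hag⟩ := RCLike.exists_norm_eq_mul_self (f g)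
  obtain ⟨b, hb, hbh⟩ := RCLike.exists_norm_eq_mul_self (f h)
  refine ⟨a, b, ?_, ?_⟩
  · rw [ContinuousMap.norm_le _ zero_le_one]
    intro s
    rcases hgh s with h0 | h0
    · simpa [h0, hb] using (h.norm_coe_le_norm s).trans hh
    · simpa [h0, ha] using (g.norm_coe_le_norm s).trans hg
  · rw [map_add, map_smul, map_smul, smul_eq_mul, smul_eq_mul, ← hag, ← hbh, ← RCLike.ofReal_add,
      RCLike.norm_ofReal, abs_of_nonneg (by positivity)]

/-- This is inner regularity: a function `g₀` vanishing on `⋂₀ C` that nearly attains the norm of `f`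
among such functions can be taken to vanish near `⋂₀ C`, hence near some `L ∈ C`. What `f` does on
functions vanishing on `⋂₀ C` but supported away from `g₀` is then negligible. -/
lemma IsNearlyFiniteOff.sInter [T2Space K] {f : C(K, 𝕜) →L[𝕜] 𝕜} {C : Set (Set K)}
    (hne : C.Nonempty) (hchain : IsChain (· ⊆ ·) C) (hclosed : ∀ L ∈ C, IsClosed L)
    (hC : ∀ L ∈ C, IsNearlyFiniteOff f L) : IsNearlyFiniteOff f (⋂₀ C) := by
  intro δ hδ
  set V : Set ℝ := {r | ∃ g : C(K, 𝕜), ‖g‖ ≤ 1 ∧ (∀ s ∈ ⋂₀ C, g s = 0) ∧ r = ‖f g‖}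
  have hbdd : BddAbove V := by
    refine ⟨‖f‖, ?_⟩
    rintro r ⟨g, hg, -, rfl⟩
    exact f.unit_le_opNorm g hg
  have hVne : V.Nonempty := ⟨_, 0, by simp, by simp, rfl⟩
  obtain ⟨_, ⟨g₀, hg₀, hg₀L, rfl⟩, hlt⟩ :=
    exists_lt_of_lt_csSup hVne (show sSup V - δ / 4 < sSup V by linarith)
  obtain ⟨η, hη, hηf⟩ : ∃ η : ℝ, 0 < η ∧ ‖f‖ * η ≤ δ / 4 := by
    refine ⟨δ / 4 / (‖f‖ + 1), by positivity, ?_⟩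
    rw [mul_div_assoc', div_le_iff₀ (by positivity)]
    nlinarith [norm_nonneg f]
  obtain ⟨g₁, hg₁, hg₁le, hg₁0⟩ := g₀.exists_truncation hη
  have hg₁n : ‖g₁‖ ≤ 1 := (ContinuousMap.norm_le _ zero_le_one).2 fun s =>
    (hg₁le s).trans ((g₀.norm_coe_le_norm s).trans hg₀)
  have hfg₁ : sSup V - δ / 2 ≤ ‖f g₁‖ := by
    have h1 : ‖f g₀ - f g₁‖ ≤ δ / 4 := by
      rw [← map_sub]
      exact (f.le_opNorm _).trans ((mul_le_mul_of_nonneg_left hg₁ (norm_nonneg _)).trans hηf)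
    have := norm_sub_norm_le (f g₀) (f g₁)
    linarith
  have hOopen : IsOpen {s | ‖g₀ s‖ < η} := isOpen_lt g₀.continuous.norm continuous_const
  obtain ⟨L, hL, hLO⟩ : ∃ L ∈ C, L ⊆ {s | ‖g₀ s‖ < η} := by
    have := hne.to_subtype
    obtain ⟨i, hi⟩ := exists_subset_nhds_of_isCompact' (V := fun i : C => (i : Set K))
      (fun a b => (hchain.total a.2 b.2).elim (fun h => ⟨a, subset_rfl, h⟩)
        fun h => ⟨b, h, subset_rfl⟩)
      (fun i => (hclosed i i.2).isCompact) (fun i => hclosed i i.2)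
      (U := {s | ‖g₀ s‖ < η}) (fun s hs => hOopen.mem_nhds (by
        rw [← Set.sInter_eq_iInter] at hs
        simp [hg₀L s hs, hη]))
    exact ⟨i, i.2, hi⟩
  obtain ⟨F, hF, hFL⟩ := hC L hL (δ / 2) (by positivity)
  obtain ⟨ψ, hψ0, hψ1, hψ⟩ := exists_continuous_zero_one_of_isClosed (hclosed L hL)
    hOopen.isClosed_compl (Set.disjoint_compl_right_iff_subset.2 hLO)
  refine ⟨F, hF, fun g hg hgL hgF => ?_⟩
  -- `a` is the part of `g` vanishing on `L`, `b` the part vanishing on the support of `g₁`.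
  set a : C(K, 𝕜) := ⟨fun s => (ψ s : 𝕜) * g s, by fun_prop⟩ with ha
  set b : C(K, 𝕜) := ⟨fun s => ((1 - ψ s : ℝ) : 𝕜) * g s, by fun_prop⟩ with hb
  have hab : g = a + b := by
    ext s
    simp only [ha, hb, ContinuousMap.add_apply, ContinuousMap.coe_mk]
    push_cast
    ring
  have han : ‖a‖ ≤ 1 := (ContinuousMap.norm_le _ zero_le_one).2 fun s => by
    have := (g.norm_coe_le_norm s).trans hg
    simp only [ha, ContinuousMap.coe_mk, norm_mul, RCLike.norm_ofReal, abs_of_nonneg (hψ s).1]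
    exact mul_le_one₀ (hψ s).2 (norm_nonneg _) this
  have hbn : ‖b‖ ≤ 1 := (ContinuousMap.norm_le _ zero_le_one).2 fun s => by
    have := (g.norm_coe_le_norm s).trans hg
    simp only [hb, ContinuousMap.coe_mk, norm_mul, RCLike.norm_ofReal,
      abs_of_nonneg (sub_nonneg.2 (hψ s).2)]
    exact mul_le_one₀ (by linarith [(hψ s).1]) (norm_nonneg _) this
  have hfa : ‖f a‖ ≤ δ / 2 := by
    refine hFL a han (fun s hs => ?_) fun s hs => ?_
    · simp [ha, hψ0 hs]
    · simp [ha, hgF s hs]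
  have hfb : ‖f g₁‖ + ‖f b‖ ≤ sSup V := by
    obtain ⟨p, q, hpq, hfpq⟩ := exists_norm_apply_eq_add f hg₁n hbn fun s => by
      rcases lt_or_ge ‖g₀ s‖ η with hs | hs
      · exact Or.inl (hg₁0 s hs.le)
      · refine Or.inr ?_
        have : ψ s = 1 := hψ1 (show s ∈ {s | ‖g₀ s‖ < η}ᶜ by simpa using hs)
        simp [hb, this]
    rw [← hfpq]
    refine le_csSup hbdd ⟨_, hpq, fun s hs => ?_, rfl⟩
    have h1 : g₁ s = 0 := hg₁0 s (by simp [hg₀L s hs, hη.le])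
    simp [h1, hb, hgL s hs]
  rw [hab, map_add]
  linarith [norm_add_le (f a) (f b)]

/-- A functional on `C(K)`, with `K` scattered, is concentrated on a finite set up to an arbitrarily
small error in norm. -/
lemma exists_finite_norm_apply_le [T2Space K] (hK : IsScatteredSpace K) (f : C(K, 𝕜) →L[𝕜] 𝕜)
    {δ : ℝ} (hδ : 0 < δ) :
    ∃ F : Set K, F.Finite ∧ ∀ g : C(K, 𝕜), (∀ s ∈ F, g s = 0) → ‖f g‖ ≤ δ * ‖g‖ := by
  have huniv : IsNearlyFiniteOff f Set.univ := fun δ hδ => ⟨∅, Set.finite_empty, fun g _ hg _ => by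
    have : g = 0 := ContinuousMap.ext fun s => hg s trivial
    simp [this, hδ.le]⟩
  obtain ⟨L, ⟨hLc, hL⟩, hmin⟩ := zorn_superset {L : Set K | IsClosed L ∧ IsNearlyFiniteOff f L} (by
    intro C hC hchain
    rcases C.eq_empty_or_nonempty with rfl | hne
    · exact ⟨Set.univ, ⟨isClosed_univ, huniv⟩, by simp⟩
    · exact ⟨⋂₀ C, ⟨isClosed_sInter fun L hL => (hC hL).1,
        .sInter hne hchain (fun L hL => (hC hL).1) fun L hL => (hC hL).2⟩,
        fun L hL => Set.sInter_subset_of_mem hL⟩)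
  have hempty : L = ∅ := by
    by_contra hne
    obtain ⟨t, htL, U, hU, hUL⟩ := hK L hLc (Set.nonempty_iff_ne_empty.2 hne)
    have htU : t ∈ U := (hUL.symm ▸ rfl : t ∈ U ∩ L).1
    have hLU : IsNearlyFiniteOff f (L \ U) := fun δ hδ => by
      obtain ⟨F, hF, hFL⟩ := hL δ hδ
      refine ⟨insert t F, hF.insert t, fun g hg hgL hgF =>
        hFL g hg (fun s hs => ?_) fun s hs => hgF s (Or.inr hs)⟩
      by_cases hsU : s ∈ U
      · have : s ∈ ({t} : Set K) := hUL ▸ ⟨hsU, hs⟩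
        exact hgF s (Or.inl this)
      · exact hgL s ⟨hs, hsU⟩
    exact (hmin ⟨hLc.sdiff hU, hLU⟩ Set.sdiff_subset htL).2 htU
  subst hempty
  obtain ⟨F, hF, hFL⟩ := hL δ hδ
  refine ⟨F, hF, fun g hg => ?_⟩
  rcases eq_or_ne g 0 with rfl | hg0
  · simp
  have hpos : 0 < ‖g‖ := norm_pos_iff.2 hg0
  have h1 : ‖f (((‖g‖⁻¹ : ℝ) : 𝕜) • g)‖ ≤ δ := by
    refine hFL _ ?_ (by simp) fun s hs => by simp [hg s hs]
    rw [norm_smul, RCLike.norm_ofReal, abs_of_pos (inv_pos.2 hpos), inv_mul_cancel₀ hpos.ne']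
  rwa [map_smul, norm_smul, RCLike.norm_ofReal, abs_of_pos (inv_pos.2 hpos), inv_mul_le_iff₀ hpos,
    mul_comm] at h1

/-- The same for finitely many functionals, and for functions that are small on the finite set
rather than zero. -/
lemma exists_finite_norm_apply_le_add [T2Space K] (hK : IsScatteredSpace K) {ι : Type*} [Finite ι]
    (f : ι → C(K, 𝕜) →L[𝕜] 𝕜) {δ : ℝ} (hδ : 0 < δ) :
    ∃ F : Set K, F.Finite ∧ ∀ (i : ι) (η : ℝ), 0 < η → ∀ g : C(K, 𝕜), (∀ s ∈ F, ‖g s‖ ≤ η) →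
      ‖f i g‖ ≤ ‖f i‖ * η + δ * ‖g‖ := by
  choose F hF hFf using fun i => exists_finite_norm_apply_le hK (f i) hδ
  refine ⟨⋃ i, F i, Set.finite_iUnion hF, fun i η hη g hg => ?_⟩
  obtain ⟨g', hgg', hle, h0⟩ := g.exists_truncation hη
  have h1 : ‖f i (g - g')‖ ≤ ‖f i‖ * η :=
    ((f i).le_opNorm _).trans (mul_le_mul_of_nonneg_left hgg' (norm_nonneg _))
  have h2 : ‖f i g'‖ ≤ δ * ‖g'‖ := hFf i g' fun s hs => h0 s (hg s (Set.mem_iUnion.2 ⟨i, hs⟩))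
  have h3 : ‖g'‖ ≤ ‖g‖ := (ContinuousMap.norm_le _ (norm_nonneg _)).2 fun s =>
    (hle s).trans (g.norm_coe_le_norm s)
  have h4 : f i g = f i (g - g') + f i g' := by simp
  rw [h4]
  have h5 := mul_le_mul_of_nonneg_left h3 hδ.le
  linarith [norm_add_le (f i (g - g')) (f i g')]

end

/-! ### Convex combinations of scalars -/

section

variable {𝕜 ι : Type*} [RCLike 𝕜] [Fintype ι]

lemma norm_sum_smul_le_one {E : Type*} [NormedAddCommGroup E] [NormedSpace 𝕜 E] {c : ι → ℝ}
    (hc : ∀ i, 0 ≤ c i) (hsum : ∑ i, c i = 1) {w : ι → E} (hw : ∀ i, ‖w i‖ ≤ 1) :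
    ‖∑ i, (c i : 𝕜) • w i‖ ≤ 1 := by
  refine (norm_sum_le _ _).trans ((Finset.sum_le_sum fun i _ => ?_).trans_eq hsum)
  rw [norm_smul, RCLike.norm_ofReal, abs_of_nonneg (hc i)]
  exact mul_le_of_le_one_right (hc i) (hw i)

/-- Strict convexity of the unit ball of `𝕜`. -/
lemma eq_sum_of_norm_sum_eq_one {c : ι → ℝ} (hc : ∀ i, 0 ≤ c i) (hsum : ∑ i, c i = 1) {w : ι → 𝕜}
    (hw : ∀ i, ‖w i‖ ≤ 1) (hx : ‖∑ i, (c i : 𝕜) * w i‖ = 1) {i : ι} (hi : c i ≠ 0) :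
    w i = ∑ j, (c j : 𝕜) * w j := by
  set x := ∑ j, (c j : 𝕜) * w j with hxdef
  -- The variance `∑ j, c j * ‖w j - x‖ ^ 2` vanishes.
  have hinner : ∑ j, c j * RCLike.re (inner 𝕜 (w j) x) = 1 := by
    have h1 : ∀ v : 𝕜, ∑ j, c j * RCLike.re (inner 𝕜 (w j) v) = RCLike.re (inner 𝕜 x v) :=
        fun v => by
      simp only [hxdef, ← smul_eq_mul (a := ((c _ : ℝ) : 𝕜)), sum_inner, inner_smul_left,
        RCLike.conj_ofReal, map_sum]
      simp only [smul_eq_mul, RCLike.re_ofReal_mul]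
    rw [h1, inner_self_eq_norm_sq, hx, one_pow]
  have hle : ∑ j, c j * ‖w j - x‖ ^ 2 ≤ 0 := by
    calc ∑ j, c j * ‖w j - x‖ ^ 2
        ≤ ∑ j, (2 * c j - 2 * (c j * RCLike.re (inner 𝕜 (w j) x))) := by
          refine Finset.sum_le_sum fun j _ => ?_
          rw [@norm_sub_sq 𝕜, hx]
          have : ‖w j‖ ^ 2 ≤ 1 := pow_le_one₀ (norm_nonneg _) (hw j)
          nlinarith [hc j]
      _ = 0 := by rw [Finset.sum_sub_distrib, ← Finset.mul_sum, ← Finset.mul_sum, hsum, hinner]; ring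
  have hnn : ∀ j ∈ Finset.univ, 0 ≤ c j * ‖w j - x‖ ^ 2 := fun j _ =>
    mul_nonneg (hc j) (sq_nonneg _)
  have h0 := (Finset.sum_eq_zero_iff_of_nonneg hnn).1 (hle.antisymm (Finset.sum_nonneg hnn)) i
    (Finset.mem_univ i)
  simpa [hi, sub_eq_zero] using h0

/-- The points `w i` of the unit ball of `𝕜` can, up to an error `κ`, be made to depend continuously
on their convex combination, which then ranges over the whole unit ball. -/
lemma exists_continuous_splitting {c : ι → ℝ} (hc : ∀ i, 0 ≤ c i) (hsum : ∑ i, c i = 1) {w : ι → 𝕜}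
    (hw : ∀ i, ‖w i‖ ≤ 1) {κ : ℝ} (hκ : 0 < κ) :
    ∃ T : ι → C(𝕜, 𝕜), (∀ i p, ‖p‖ ≤ 1 → ‖T i p‖ ≤ 1) ∧ (∀ p, ∑ i, (c i : 𝕜) * T i p = p) ∧
      ∀ i, ‖T i (∑ j, (c j : 𝕜) * w j) - w i‖ < κ := by
  have hsum' : ∑ i, (c i : 𝕜) = 1 := by rw [← RCLike.ofReal_sum, hsum, RCLike.ofReal_one]
  have hx1 : ‖∑ i, (c i : 𝕜) * w i‖ ≤ 1 := norm_sum_smul_le_one (𝕜 := 𝕜) hc hsum hw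
  rcases hx1.lt_or_eq with hx | hx
  · set x := ∑ i, (c i : 𝕜) * w i with hxdef
    obtain ⟨δ, hδ0, hδ1, hδκ⟩ : ∃ δ : ℝ, 0 < δ ∧ δ ≤ 1 ∧ 2 * δ < κ :=
      ⟨min 1 (κ / 4), by positivity, min_le_left _ _, by linarith [min_le_right 1 (κ / 4)]⟩
    set r := δ * (1 - ‖x‖) with hr
    have hr0 : 0 < r := mul_pos hδ0 (by linarith)
    -- `w i` is pulled towards `x` to `v i`, whose distance to the unit sphere is at least `r`.
    set v : ι → 𝕜 := fun i => w i + (δ : 𝕜) * (x - w i) with hv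
    have hvn : ∀ i, ‖v i‖ ≤ 1 - r := fun i => by
      have h1 : v i = ((1 - δ : ℝ) : 𝕜) * w i + (δ : 𝕜) * x := by
        simp only [hv]
        push_cast
        ring
      rw [h1]
      refine (norm_add_le _ _).trans ?_
      rw [norm_mul, norm_mul, RCLike.norm_ofReal, RCLike.norm_ofReal, abs_of_pos hδ0,
        abs_of_nonneg (by linarith)]
      nlinarith [hw i]
    have hvsum : ∑ i, (c i : 𝕜) * (v i - x) = 0 := by
      have h1 : ∀ i, (c i : 𝕜) * (v i - x) = ((1 : 𝕜) - δ) * (c i * w i) - (1 - δ) * x * c i :=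
        fun i => by simp only [hv]; ring
      rw [Finset.sum_congr rfl fun i _ => h1 i, Finset.sum_sub_distrib, ← Finset.mul_sum,
        ← Finset.mul_sum, hsum', ← hxdef]
      ring
    set θ : 𝕜 → ℝ := fun p => max 0 (1 - ‖p - x‖ / r) with hθ
    have hθ0 : ∀ p, 0 ≤ θ p := fun p => le_max_left _ _
    have hθ1 : ∀ p, θ p ≤ 1 := fun p => max_le zero_le_one (by
      have : 0 ≤ ‖p - x‖ / r := by positivity
      linarith)
    refine ⟨fun i => ⟨fun p => p + (θ p : 𝕜) * (v i - x), by fun_prop⟩, fun i p hp => ?_,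
      fun p => ?_, fun i => ?_⟩
    · simp only [ContinuousMap.coe_mk]
      rcases le_total r ‖p - x‖ with hpr | hpr
      · have : θ p = 0 := max_eq_left (by linarith [(one_le_div hr0).2 hpr])
        simpa [this] using hp
      · have h1 : p + (θ p : 𝕜) * (v i - x) =
            ((1 - θ p : ℝ) : 𝕜) * p + (θ p : 𝕜) * (v i + (p - x)) := by
          push_cast
          ring
        have h2 : ‖v i + (p - x)‖ ≤ 1 := (norm_add_le _ _).trans (by linarith [hvn i])
        rw [h1]
        refine (norm_add_le _ _).trans ?_
        rw [norm_mul, norm_mul, RCLike.norm_ofReal, RCLike.norm_ofReal, abs_of_nonneg (hθ0 p),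
          abs_of_nonneg (sub_nonneg.2 (hθ1 p))]
        nlinarith [hθ0 p, hθ1 p]
    · have h1 : ∀ i, (c i : 𝕜) * (p + (θ p : 𝕜) * (v i - x)) =
          p * c i + θ p * (c i * (v i - x)) := fun i => by ring
      simp only [ContinuousMap.coe_mk, h1]
      rw [Finset.sum_add_distrib, ← Finset.mul_sum, ← Finset.mul_sum, hvsum, hsum']
      ring
    · have h1 : θ x = 1 := by simp [hθ]
      have h2 : x + ((1 : ℝ) : 𝕜) * (v i - x) - w i = (δ : 𝕜) * (x - w i) := by
        simp only [hv]
        push_cast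
        ring
      simp only [ContinuousMap.coe_mk, h1, h2]
      rw [norm_mul, RCLike.norm_ofReal, abs_of_pos hδ0]
      have h3 : ‖x - w i‖ ≤ 2 := (norm_sub_le _ _).trans (by linarith [hw i])
      nlinarith
  -- Here only the `w i` of weight zero can differ from the convex combination.
  · classical
    refine ⟨fun i => if c i = 0 then .const 𝕜 (w i) else .id 𝕜, fun i p hp => ?_, fun p => ?_,
      fun i => ?_⟩
    · dsimp only
      split_ifs
      · exact hw i
      · exact hp
    · have h1 : ∀ i, (c i : 𝕜) * (if c i = 0 then ContinuousMap.const 𝕜 (w i) else .id 𝕜) p =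
          c i * p := fun i => by
        split_ifs with hi <;> simp [hi]
      simp only [h1]
      rw [← Finset.sum_mul, hsum', one_mul]
    · dsimp only
      split_ifs with hi
      · simpa using hκ
      · simpa [← eq_sum_of_norm_sum_eq_one hc hsum hw hx hi] using hκ

end

/-! ### Gluing and weak openness -/

section

variable {𝕜 K : Type*} [RCLike 𝕜] [TopologicalSpace K] [CompactSpace K]

lemma exists_bump_functions [T2Space K] {F : Set K} (hF : F.Finite) [Fintype F] :
    ∃ ψ : F → C(K, ℝ), (∀ t s, 0 ≤ ψ t s) ∧ (∀ s, ∑ t, ψ t s ≤ 1) ∧ (∀ t, ψ t t = 1) ∧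
      ∀ t t' : F, t ≠ t' → ψ t t' = 0 := by
  obtain ⟨ψ, hψ⟩ := PartitionOfUnity.exists_isSubordinate hF.isClosed
    (fun t : F => (F \ {(t : K)})ᶜ) (fun t => hF.sdiff.isClosed.isOpen_compl)
    (fun s hs => Set.mem_iUnion.2 ⟨⟨s, hs⟩, by simp⟩)
  have h0 : ∀ t t' : F, t ≠ t' → ψ t t' = 0 := fun t t' htt' => by
    by_contra h
    exact hψ t (subset_tsupport _ h) ⟨t'.2, fun h' => htt' (Subtype.ext h').symm⟩
  refine ⟨ψ, fun t s => ψ.nonneg t s, fun s => ?_, fun t => ?_, h0⟩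
  · simpa [finsum_eq_sum_of_fintype] using ψ.sum_le_one s
  · have := ψ.sum_eq_one t.2
    rwa [finsum_eq_sum_of_fintype, Finset.sum_eq_single t (fun t' _ h => h0 t' t h)
      (fun h => absurd (Finset.mem_univ t) h)] at this

/-- Splittings of scalars, one for each point of a finite set `F`, glue to a splitting of a function
`y` in the unit ball that is given by `T t` at `t ∈ F`. -/
lemma exists_splitting_of_finite [T2Space K] {ι : Type*} [Fintype ι] {F : Set K} (hF : F.Finite)
    {c : ι → ℝ} (hsum : ∑ i, c i = 1) {T : F → ι → C(𝕜, 𝕜)}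
    (hT : ∀ t i p, ‖p‖ ≤ 1 → ‖T t i p‖ ≤ 1) (hTsum : ∀ t p, ∑ i, (c i : 𝕜) * T t i p = p)
    {y : C(K, 𝕜)} (hy : ‖y‖ ≤ 1) :
    ∃ u : ι → C(K, 𝕜), (∀ i, ‖u i‖ ≤ 1) ∧ y = ∑ i, (c i : 𝕜) • u i ∧
      ∀ i (t : F), u i t = T t i (y t) := by
  have := hF.fintype
  obtain ⟨ψ, hψ0, hψ1, hψt, hψtt'⟩ := exists_bump_functions hF
  have hsum' : ∑ i, (c i : 𝕜) = 1 := by rw [← RCLike.ofReal_sum, hsum, RCLike.ofReal_one]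
  have hy' : ∀ s, ‖y s‖ ≤ 1 := fun s => (y.norm_coe_le_norm s).trans hy
  refine ⟨fun i => ⟨fun s => y s + ∑ t, (ψ t s : 𝕜) * (T t i (y s) - y s), by fun_prop⟩,
    fun i => (ContinuousMap.norm_le _ zero_le_one).2 fun s => ?_, ?_, fun i t => ?_⟩
  · have h1 : y s + ∑ t, (ψ t s : 𝕜) * (T t i (y s) - y s) =
        ((1 - ∑ t, ψ t s : ℝ) : 𝕜) * y s + ∑ t, (ψ t s : 𝕜) * T t i (y s) := by
      simp only [mul_sub, Finset.sum_sub_distrib, ← Finset.sum_mul]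
      push_cast
      ring
    simp only [ContinuousMap.coe_mk]
    rw [h1]
    calc _ ≤ (1 - ∑ t, ψ t s) + ∑ t, ψ t s := by
          refine (norm_add_le _ _).trans (add_le_add ?_ ((norm_sum_le _ _).trans
            (Finset.sum_le_sum fun t _ => ?_)))
          · rw [norm_mul, RCLike.norm_ofReal, abs_of_nonneg (sub_nonneg.2 (hψ1 s))]
            exact mul_le_of_le_one_right (sub_nonneg.2 (hψ1 s)) (hy' s)
          · rw [norm_mul, RCLike.norm_ofReal, abs_of_nonneg (hψ0 t s)]
            exact mul_le_of_le_one_right (hψ0 t s) (hT t i _ (hy' s))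
      _ = 1 := by ring
  · ext s
    have h1 : ∀ t, ∑ i, (c i : 𝕜) * ((ψ t s : 𝕜) * (T t i (y s) - y s)) = 0 := fun t => by
      have h2 : ∀ i, (c i : 𝕜) * ((ψ t s : 𝕜) * (T t i (y s) - y s)) =
          ψ t s * (c i * T t i (y s)) - ψ t s * y s * c i := fun i => by ring
      rw [Finset.sum_congr rfl fun i _ => h2 i, Finset.sum_sub_distrib, ← Finset.mul_sum,
        ← Finset.mul_sum, hTsum, hsum']
      ring
    simp only [ContinuousMap.sum_apply, ContinuousMap.smul_apply, ContinuousMap.coe_mk, smul_eq_mul,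
      mul_add, Finset.sum_add_distrib, Finset.mul_sum]
    rw [Finset.sum_comm, Finset.sum_congr rfl fun t _ => h1 t, ← Finset.sum_mul, hsum']
    simp
  · simp only [ContinuousMap.coe_mk]
    rw [Finset.sum_eq_single t (fun t' _ h => by simp [hψtt' t' t h])
      (fun h => absurd (Finset.mem_univ t) h), hψt]
    simp

end

lemma continuous_weakSpace_eval {𝕜 K : Type*} [RCLike 𝕜] [TopologicalSpace K] [CompactSpace K]
    (t : K) :
    Continuous fun y : WeakSpace 𝕜 C(K, 𝕜) => ((toWeakSpace 𝕜 C(K, 𝕜)).symm y) t :=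
  WeakBilin.eval_continuous (topDualPairing 𝕜 C(K, 𝕜)).flip (ContinuousMap.evalCLM 𝕜 t)

lemma isRelWeaklyOpen_of_forall_mem {𝕜 X : Type*} [RCLike 𝕜] [NormedAddCommGroup X]
    [NormedSpace 𝕜 X] {C B : Set X} (hCB : C ⊆ B)
    (h : ∀ x ∈ C, ∃ U : Set (WeakSpace 𝕜 X), IsOpen U ∧ toWeakSpace 𝕜 X x ∈ U ∧
      ∀ y ∈ B, toWeakSpace 𝕜 X y ∈ U → y ∈ C) : IsRelWeaklyOpen 𝕜 C B := by
  choose! U hU hxU hUC using h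
  refine ⟨⋃ x ∈ C, U x, isOpen_biUnion hU, Set.Subset.antisymm (fun x hx => ⟨hCB hx, ?_⟩) ?_⟩
  · exact Set.mem_biUnion hx (hxU x hx)
  · rintro y ⟨hyB, hy⟩
    obtain ⟨x, hx, hyx⟩ := Set.mem_iUnion₂.1 hy
    exact hUC x hx y hyB hyx

theorem theorem2p3 {𝕜 : Type*} [RCLike 𝕜] {K : Type*} [TopologicalSpace K] [CompactSpace K]
    [T2Space K] (hK : IsScatteredSpace K) {n : ℕ} (f : Fin n → (C(K, 𝕜) →L[𝕜] 𝕜)) (ε : Fin n → ℝ)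
    (c : Fin n → ℝ) (hf : ∀ i, ‖f i‖ = 1) (hε : ∀ i, 0 < ε i) (hc : ∀ i, 0 ≤ c i)
    (hsum : ∑ i, c i = 1) :
    IsRelWeaklyOpen 𝕜 (setCombination 𝕜 c fun i => unitBallSlice (f i) (ε i))
      (Metric.closedBall (0 : C(K, 𝕜)) 1) := by
  refine isRelWeaklyOpen_of_forall_mem ?_ ?_
  · rintro _ ⟨z, hz, rfl⟩
    exact mem_closedBall_zero_iff.2
      (norm_sum_smul_le_one hc hsum fun i => mem_closedBall_zero_iff.1 (hz i).1)
  rintro _ ⟨z, hz, rfl⟩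
  have hz1 : ∀ i, ‖z i‖ ≤ 1 := fun i => mem_closedBall_zero_iff.1 (hz i).1
  -- Passing from `z i` to `u i` costs `κ` on `F` and `2 * κ` off `F`: a third of the slack in
  -- `hz` suffices.
  obtain ⟨κ, hκz, hκ⟩ : ∃ κ : ℝ,
      (∀ i, κ < (RCLike.re (f i (z i)) - (1 - ε i)) / 3) ∧ 0 < κ :=
    ((Filter.eventually_all.2 fun i => nhdsWithin_le_nhds (eventually_lt_nhds
      (div_pos (sub_pos.2 (hz i).2) zero_lt_three))).and
        (self_mem_nhdsWithin : Set.Ioi (0 : ℝ) ∈ 𝓝[>] 0)).exists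
  obtain ⟨F, hF, hFf⟩ := exists_finite_norm_apply_le_add hK f hκ
  choose T hT hTsum hTz using fun t : F => exists_continuous_splitting hc hsum
    (w := fun i => z i t) (fun i => ((z i).norm_coe_le_norm t).trans (hz1 i)) hκ
  have := hF.to_subtype
  refine ⟨⋂ (t : F) (i : Fin n),
    {y | ‖T t i ((toWeakSpace 𝕜 C(K, 𝕜)).symm y t) - z i t‖ < κ}, ?_, ?_, fun y hy hyU => ?_⟩
  · exact isOpen_iInter_of_finite fun t => isOpen_iInter_of_finite fun i =>
      isOpen_lt (((T t i).continuous.comp (continuous_weakSpace_eval _)).sub continuous_const).norm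
        continuous_const
  · refine Set.mem_iInter₂.2 fun t i => ?_
    have h := hTz t i
    simp only [← smul_eq_mul] at h
    simpa only [Set.mem_ofPred_eq, LinearEquiv.symm_apply_apply, ContinuousMap.sum_apply,
      ContinuousMap.smul_apply] using h
  · obtain ⟨u, hu1, hyu, huT⟩ := exists_splitting_of_finite hF hsum hT hTsum
      (mem_closedBall_zero_iff.1 hy)
    refine ⟨u, fun i => ⟨mem_closedBall_zero_iff.2 (hu1 i), ?_⟩, hyu⟩
    have h1 : ‖f i (z i - u i)‖ ≤ ‖f i‖ * κ + κ * ‖z i - u i‖ := by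
      refine hFf i κ hκ _ fun s hs => ?_
      have := Set.mem_iInter₂.1 hyU ⟨s, hs⟩ i
      rw [ContinuousMap.sub_apply, norm_sub_rev, huT i ⟨s, hs⟩]
      simpa using this.le
    have h2 : ‖z i - u i‖ ≤ 2 := (norm_sub_le _ _).trans (by linarith [hz1 i, hu1 i])
    have h3 := RCLike.re_le_norm (f i (z i - u i))
    rw [map_sub, map_sub] at h3
    rw [map_sub, hf i] at h1
    nlinarith [hκz i]
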